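/- Let $X$ be a complex manifold of complex dimension $n$ with complex structure $J$, and let $\omega$ be a Hermitian metric on $X$, given by a smooth Riemannian metric $g$ with $g(Ju,Jv)=g(u,v)$, extended complex-bilinearly to $TX\otimes\mathbb{C}$. Let ${}^c\nabla$ be the Chern connection on $T^{1,0}X$ (the unique connection with $\nabla g=0$ and $\nabla^{0,1}=\bar\partial$), let ${}^l\nabla$ be the Lichnerowicz connection (the complexified Levi-Civita connection of $g$ restricted and projected to $T^{1,0}X$), and for $t\in\mathbb{R}$ let ${}^t\nabla = t\,{}^c\nabla+(1-t)\,{}^l\nabla$ be the $t$-Gauduchon connection, with curvature tensor ${}^tR(u,\bar v,w,\bar z)=g({}^t\Theta(u,\bar v)w,\bar z)$, where ${}^t\Theta(u,\bar v)=[{}^t\nabla_u,{}^t\nabla_{\bar v}]-{}^t\nabla_{[u,\bar v]}$. The $t$-Gauduchon holomorphic sectional curvature is $${}^t\mathrm{HSC}_\omega(v)=\frac{{}^tR(v,\bar v,v,\bar v)}{|v|_\omega^4},\qquad 0\ne v\in T^{1,0}X,$$ where $|v|_\omega^2=g(v,\bar v)$, and ${}^c\mathrm{HSC}_\omega$ is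 the same expression for ${}^c\nabla={}^1\nabla$. These curvatures are real-valued. Inequalities such as ${}^t\mathrm{HSC}_\omega\le 0$ mean that the inequality holds at every point of $X$ and for every non-zero $v$. Then: (i) If ${}^c\mathrm{HSC}_\omega\le 0$, then ${}^t\mathrm{HSC}_\omega\le 0$ for every $t\in\mathbb{R}$. Likewise, if ${}^c\mathrm{HSC}_\omega<0$, then ${}^t\mathrm{HSC}_\omega<0$ for every $t\in\mathbb{R}$. (ii) If ${}^t\mathrm{HSC}_\omega>0$ for some $t\in\mathbb{R}$, then ${}^c\mathrm{HSC}_\omega>0$. In particular, negative (respectively, positive) Chern holomorphic sectional curvature is the strongest (respectively, weakest) such condition along the line of Gauduchon connections. -/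

import Mathlib

open scoped Manifold ContDiff Matrix

noncomputable section

namespace Gauduchon

/-- The model space `ℂⁿ`. -/
abbrev Cn (n : ℕ) : Type := EuclideanSpace ℂ (Fin n)

/-- A complex manifold is, by restriction of scalars, a smooth real manifold. -/
instance isManifoldReal (n : ℕ) (X : Type*) [TopologicalSpace X] [ChartedSpace (Cn n) X]
    [IsManifold 𝓘(ℂ, Cn n) ω X] : IsManifold 𝓘(ℝ, Cn n) ω X := by
  apply isManifold_of_contDiffOn
  intro e e' he he'
  have h := (contDiffGroupoid ω 𝓘(ℂ, Cn n)).compatible he he'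
  rw [contDiffGroupoid, mem_groupoid_of_pregroupoid] at h
  exact ContDiffOn.restrict_scalars ℝ h.1

/-- The almost complex structure `J` of a complex manifold: multiplication by `i` on each tangent
space. -/
def almostComplex {n : ℕ} {X : Type*} [TopologicalSpace X] [ChartedSpace (Cn n) X] (x : X) :
    TangentSpace 𝓘(ℝ, Cn n) x → TangentSpace 𝓘(ℝ, Cn n) x :=
  fun u =>
    let w : Cn n := u
    Complex.I • w

/-- A Hermitian metric on a complex manifold `X`: a smooth Riemannian metric `g` with
`g(Ju, Jv) = g(u, v)`. -/
structure HermitianMetric (n : ℕ) (X : Type*) [TopologicalSpace X] [ChartedSpace (Cn n) X]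
    [IsManifold 𝓘(ℂ, Cn n) ω X] extends
    Bundle.ContMDiffRiemannianMetric (B := X) 𝓘(ℝ, Cn n) ∞ (Cn n)
      (fun x : X => TangentSpace 𝓘(ℝ, Cn n) x) where
  compatible : ∀ (x : X) (u v : TangentSpace 𝓘(ℝ, Cn n) x),
    inner x (almostComplex x u) (almostComplex x v) = inner x u v

/-! ### The complexified coordinate frame

The complexified tangent bundle over a holomorphic chart with coordinates `z₁, …, zₙ` has the frame
`∂/∂zᵢ = (∂/∂xᵢ - i ∂/∂yᵢ) / 2`, indexed by `Sum.inl i`, and `∂/∂z̄ᵢ = (∂/∂xᵢ + i ∂/∂yᵢ) / 2`,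
indexed by `Sum.inr i`. -/

/-- Index set of the complexified coordinate frame. -/
abbrev Idx (n : ℕ) : Type := Fin n ⊕ Fin n

/-- The real coordinate vector `∂/∂xᵢ`, where `A` is `inl i` or `inr i`; then `∂/∂yᵢ` is
`Complex.I • dx A`. -/
def dx {n : ℕ} (A : Idx n) : Cn n := EuclideanSpace.single (Sum.elim id id A) (1 : ℂ)

/-- The coefficient `∓ i` in `(∂/∂x ∓ i ∂/∂y) / 2`. -/
def frameCoeff {n : ℕ} (A : Idx n) : ℂ := Sum.elim (fun _ => -Complex.I) (fun _ => Complex.I) A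

/-- The Wirtinger derivatives `∂f/∂zᵢ` and `∂f/∂z̄ᵢ` of a complex-valued function. -/
def wirtinger {n : ℕ} (A : Idx n) (f : Cn n → ℂ) (z : Cn n) : ℂ :=
  (1 / 2) * (fderiv ℝ f z (dx A) + frameCoeff A * fderiv ℝ f z (Complex.I • dx A))

/-- Entrywise Wirtinger derivative of a matrix-valued function. -/
def wirtingerMatrix {n : ℕ} (A : Idx n) (M : Cn n → Matrix (Fin n) (Fin n) ℂ) (z : Cn n) :
    Matrix (Fin n) (Fin n) ℂ :=
  Matrix.of fun j k => wirtinger A (fun y => M y j k) z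

section Local

variable {n : ℕ} {X : Type*} [TopologicalSpace X] [ChartedSpace (Cn n) X]
  [IsManifold 𝓘(ℂ, Cn n) ω X]

/-- The Riemannian metric read in the chart `e`: `g(u, w)` at the point with coordinates `z`, where
`u, w ∈ ℂⁿ` stand for the tangent vectors with these real coordinates. -/
def realMetric (g : HermitianMetric n X) (e : OpenPartialHomeomorph X (Cn n)) (z u w : Cn n) : ℝ :=
  g.inner (e.symm z)
    (mfderiv 𝓘(ℝ, Cn n) 𝓘(ℝ, Cn n) e.symm z u) (mfderiv 𝓘(ℝ, Cn n) 𝓘(ℝ, Cn n) e.symm z w)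

/-- The components `g_{AB}` of the complex-bilinear extension of `g` in the complexified coordinate
frame. -/
def cMetric (g : HermitianMetric n X) (e : OpenPartialHomeomorph X (Cn n)) (z : Cn n) :
    Matrix (Idx n) (Idx n) ℂ :=
  Matrix.of fun A B =>
    (1 / 4) * ((realMetric g e z (dx A) (dx B) : ℂ)
      + frameCoeff B * (realMetric g e z (dx A) (Complex.I • dx B) : ℂ)
      + frameCoeff A * (realMetric g e z (Complex.I • dx A) (dx B) : ℂ)
      + frameCoeff A * frameCoeff B
        * (realMetric g e z (Complex.I • dx A) (Complex.I • dx B) : ℂ))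

/-- The Hermitian matrix `g_{i j̄} = g(∂/∂zᵢ, ∂/∂z̄ⱼ)`. -/
def hMetric (g : HermitianMetric n X) (e : OpenPartialHomeomorph X (Cn n)) (z : Cn n) :
    Matrix (Fin n) (Fin n) ℂ :=
  Matrix.of fun i j => cMetric g e z (Sum.inl i) (Sum.inr j)

/-- The Christoffel symbols `Γ_{AB}^C` of the complex-linear extension of the Levi-Civita connection
of `g` in the complexified coordinate frame (`∇_{∂_A} ∂_B = ∑_C Γ_{AB}^C ∂_C`). -/
def leviCivita (g : HermitianMetric n X) (e : OpenPartialHomeomorph X (Cn n)) (z : Cn n)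
    (A B C : Idx n) : ℂ :=
  (1 / 2) * ∑ D : Idx n, (wirtinger A (fun y => cMetric g e y B D) z
      + wirtinger B (fun y => cMetric g e y A D) z
      - wirtinger D (fun y => cMetric g e y A B) z) * (cMetric g e z)⁻¹ D C

/-- A connection on `T^{1,0}` over a chart, given by its connection matrices in the frame
`∂/∂z₁, …, ∂/∂zₙ`: `∇_{∂_A} ∂/∂zⱼ = ∑ₖ (θ z A) j k ∂/∂zₖ`. -/
abbrev ConnForm (n : ℕ) : Type := Cn n → Idx n → Matrix (Fin n) (Fin n) ℂ

/-- The Lichnerowicz connection: the restriction to `T^{1,0}` (followed by the projection to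
`T^{1,0}`) of the complexified Levi-Civita connection. -/
def lichnerowicz (g : HermitianMetric n X) (e : OpenPartialHomeomorph X (Cn n)) : ConnForm n :=
  fun z A => Matrix.of fun j k => leviCivita g e z A (Sum.inl j) (Sum.inl k)

/-- The Chern connection, i.e. the unique connection on `T^{1,0}` with `∇g = 0` and `∇^{0,1} = ∂̄`:
its connection matrices are `∂g · g⁻¹` in the `(1,0)`-directions, and vanish in the
`(0,1)`-directions. -/
def chern (g : HermitianMetric n X) (e : OpenPartialHomeomorph X (Cn n)) : ConnForm n :=
  fun z A => Sum.elim
    (fun i => wirtingerMatrix (Sum.inl i) (hMetric g e) z * (hMetric g e z)⁻¹) (fun _ => 0) A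

/-- The `t`-Gauduchon connection `t · (Chern) + (1 - t) · (Lichnerowicz)`. -/
def gauduchon (g : HermitianMetric n X) (t : ℝ) (e : OpenPartialHomeomorph X (Cn n)) : ConnForm n :=
  fun z A => (t : ℂ) • chern g e z A + ((1 - t : ℝ) : ℂ) • lichnerowicz g e z A

/-- The curvature `Θ(∂_A, ∂_B) = [∇_{∂_A}, ∇_{∂_B}]` of a connection on `T^{1,0}`, as a matrix:
`Θ(∂_A, ∂_B) ∂/∂zⱼ = ∑ₖ (curvature θ z A B) j k ∂/∂zₖ`. -/
def curvature (θ : ConnForm n) (z : Cn n) (A B : Idx n) : Matrix (Fin n) (Fin n) ℂ :=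
  wirtingerMatrix A (fun y => θ y B) z - wirtingerMatrix B (fun y => θ y A) z
    + θ z B * θ z A - θ z A * θ z B

/-- `R_{i j̄ k l̄} = g(Θ(∂/∂zᵢ, ∂/∂z̄ⱼ) ∂/∂zₖ, ∂/∂z̄ₗ)`. -/
def curvatureTensor (g : HermitianMetric n X) (e : OpenPartialHomeomorph X (Cn n)) (θ : ConnForm n)
    (z : Cn n) (i j k l : Fin n) : ℂ :=
  (curvature θ z (Sum.inl i) (Sum.inr j) * hMetric g e z) k l

/-- `|v|² = g(v, v̄)` for `v = ∑ᵢ vᵢ ∂/∂zᵢ`. -/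
def normSq (g : HermitianMetric n X) (e : OpenPartialHomeomorph X (Cn n)) (z v : Cn n) : ℂ :=
  ∑ i, ∑ j, hMetric g e z i j * v i * star (v j)

/-- `R(v, v̄, v, v̄) / |v|⁴` for `v = ∑ᵢ vᵢ ∂/∂zᵢ` at the point with coordinates `z`. -/
def chartHSC (g : HermitianMetric n X) (e : OpenPartialHomeomorph X (Cn n)) (θ : ConnForm n)
    (z v : Cn n) : ℂ :=
  (∑ i, ∑ j, ∑ k, ∑ l, curvatureTensor g e θ z i j k l * v i * star (v j) * v k * star (v l))
    / normSq g e z v ^ 2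

end Local

section Global

variable {n : ℕ} {X : Type*} [TopologicalSpace X] [ChartedSpace (Cn n) X]
  [IsManifold 𝓘(ℂ, Cn n) ω X]

/-- The holomorphic sectional curvature `R(v, v̄, v, v̄) / |v|⁴` of a connection on `T^{1,0}X`
(given by its connection matrices in all charts) as a complex number, computed in the preferred
chart at `x`. The complex vector space `T_xX ≅ T_x^{1,0}X` is identified with `ℂⁿ` by the
same chart, so the coordinates of `v` are its components in the frame `∂/∂zᵢ` at `x`. -/
def complexHSC (g : HermitianMetric n X) (θ : OpenPartialHomeomorph X (Cn n) → ConnForm n) (x : X)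
    (v : TangentSpace 𝓘(ℂ, Cn n) x) : ℂ :=
  chartHSC g (chartAt (Cn n) x) (θ (chartAt (Cn n) x)) (chartAt (Cn n) x x) (v : Cn n)

/-- The Chern holomorphic sectional curvature. -/
def chernHSC (g : HermitianMetric n X) (x : X) (v : TangentSpace 𝓘(ℂ, Cn n) x) : ℝ :=
  (complexHSC g (chern g) x v).re

/-- The `t`-Gauduchon holomorphic sectional curvature. -/
def gauduchonHSC (g : HermitianMetric n X) (t : ℝ) (x : X) (v : TangentSpace 𝓘(ℂ, Cn n) x) : ℝ :=
  (complexHSC g (gauduchon g t) x v).re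

end Global

end Gauduchon

end

/-! Everything follows from one pointwise identity. In a holomorphic chart let H be the Hermitian
matrix of the metric, T_i its torsion matrices and c = (1 - t)/2. Then R^t(v, v̄, v, v̄) = R^c(v,
v̄, v, v̄) - c² · ∑ ((T_j)ᴴ H⁻¹ T_i)_{kl} v_i v̄_j v_k v̄_l, and the subtracted sum is nonnegative
because H⁻¹ is positive. Hence at each point and each v the Chern holomorphic sectional curvature is
the largest on the Gauduchon line, which yields all three sign implications.

The identity (`contract_gauduchon`) comes about as follows. Compatibility of g with J makes T^{1,0}
and T^{0,1} isotropic, so the Levi-Civita symbols reduce to derivatives of H, and the Gauduchon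
connection is the Chern connection plus c times torsion (`gauduchon_inl`, `gauduchon_inr`). Its
curvature, lowered with H (`curvature_mul`), is the Chern tensor plus torsion terms. Contraction
with v v̄ v v̄ is symmetric in the two holomorphic and in the two antiholomorphic slots, while
torsion is antisymmetric. Every correction term therefore vanishes except the product of conjugate
torsion and torsion, whose antisymmetric pairs are summed over; its sign comes from `cotorsion_eq`.
-/

namespace Gauduchon

/-! ### The metric in a holomorphic chart -/

section Geometry

variable {n : ℕ} {X : Type*} [TopologicalSpace X] [ChartedSpace (Cn n) X]
  [IsManifold 𝓘(ℂ, Cn n) ω X]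

/-- The real derivative of an inverse holomorphic chart is complex linear. -/
theorem mfderiv_chart_symm_I_smul {e : OpenPartialHomeomorph X (Cn n)} (he : e ∈ atlas (Cn n) X)
    {z : Cn n} (hz : z ∈ e.target) (u : Cn n) :
    mfderiv 𝓘(ℝ, Cn n) 𝓘(ℝ, Cn n) e.symm z (Complex.I • u)
      = almostComplex (e.symm z) (mfderiv 𝓘(ℝ, Cn n) 𝓘(ℝ, Cn n) e.symm z u) := by
  have h1 : MDifferentiableAt 𝓘(ℂ, Cn n) 𝓘(ℂ, Cn n) e.symm z := by
    have : IsManifold 𝓘(ℂ, Cn n) 1 X := IsManifold.of_le (n := ω) le_top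
    exact mdifferentiableAt_atlas_symm he hz
  have h2 := h1.hasMFDerivAt
  -- Both manifold structures use the same charts, so the complex derivative with scalars restricted
  -- is the real one, by uniqueness of derivatives.
  have h3 : HasFDerivWithinAt (𝕜 := ℂ)
      (writtenInExtChartAt 𝓘(ℂ, Cn n) 𝓘(ℂ, Cn n) z e.symm : Cn n → Cn n)
      (mfderiv 𝓘(ℂ, Cn n) 𝓘(ℂ, Cn n) e.symm z : Cn n →L[ℂ] Cn n) (Set.range 𝓘(ℂ, Cn n))
      ((extChartAt 𝓘(ℂ, Cn n) z) z) := h2.2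
  have h4 := h3.restrictScalars ℝ
  have h5 : HasMFDerivAt 𝓘(ℝ, Cn n) 𝓘(ℝ, Cn n) e.symm z
      ((mfderiv 𝓘(ℂ, Cn n) 𝓘(ℂ, Cn n) e.symm z : Cn n →L[ℂ] Cn n).restrictScalars ℝ :
        Cn n →L[ℝ] Cn n) := ⟨h2.1, h4⟩
  rw [h5.mfderiv]
  exact (mfderiv 𝓘(ℂ, Cn n) 𝓘(ℂ, Cn n) e.symm z : Cn n →L[ℂ] Cn n).map_smul Complex.I u

theorem mfderiv_chart_symm_injective {e : OpenPartialHomeomorph X (Cn n)}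
    (he : e ∈ atlas (Cn n) X) {z : Cn n} (hz : z ∈ e.target) :
    Function.Injective (mfderiv 𝓘(ℝ, Cn n) 𝓘(ℝ, Cn n) e.symm z) := by
  have : IsManifold 𝓘(ℝ, Cn n) 1 X := IsManifold.of_le (n := ω) le_top
  exact (mdifferentiable_of_mem_atlas (I := 𝓘(ℝ, Cn n)) he).symm.mfderiv_injective hz

variable (g : HermitianMetric n X) (e : OpenPartialHomeomorph X (Cn n))

theorem realMetric_add_left (z u v w : Cn n) :
    realMetric g e z (u + v) w = realMetric g e z u w + realMetric g e z v w := by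
  unfold realMetric
  have := (mfderiv 𝓘(ℝ, Cn n) 𝓘(ℝ, Cn n) e.symm z).map_add u v
  erw [this, map_add]; rfl

theorem realMetric_smul_left (z : Cn n) (a : ℝ) (u w : Cn n) :
    realMetric g e z (a • u) w = a * realMetric g e z u w := by
  unfold realMetric
  have := (mfderiv 𝓘(ℝ, Cn n) 𝓘(ℝ, Cn n) e.symm z).map_smul a u
  erw [this, map_smul]; rfl

theorem realMetric_symm (z u w : Cn n) : realMetric g e z u w = realMetric g e z w u :=
  g.symm _ _ _

variable {e}

theorem realMetric_I_smul (he : e ∈ atlas (Cn n) X) {z : Cn n} (hz : z ∈ e.target) (u w : Cn n) :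
    realMetric g e z (Complex.I • u) (Complex.I • w) = realMetric g e z u w := by
  unfold realMetric
  rw [mfderiv_chart_symm_I_smul he hz, mfderiv_chart_symm_I_smul he hz]
  exact g.compatible _ _ _

theorem realMetric_pos (he : e ∈ atlas (Cn n) X) {z : Cn n} (hz : z ∈ e.target) {u : Cn n}
    (hu : u ≠ 0) : 0 < realMetric g e z u u := by
  refine g.pos _ _ fun h => hu (mfderiv_chart_symm_injective he hz ?_)
  rw [h]; exact (map_zero _).symm

/-- The tangent map of the inverse chart carries constant vector fields to smooth sections along it,
and the smooth bilinear form g is evaluated on two of these. -/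
theorem contDiffAt_realMetric (he : e ∈ atlas (Cn n) X) {z : Cn n} (hz : z ∈ e.target)
    (u w : Cn n) : ContDiffAt ℝ ∞ (fun y => realMetric g e y u w) z := by
  have hsymm : ContMDiffOn 𝓘(ℝ, Cn n) 𝓘(ℝ, Cn n) ω e.symm e.target :=
    contMDiffOn_symm_of_mem_maximalAtlas (IsManifold.subset_maximalAtlas he)
  have hvec (u : Cn n) : ContMDiffAt 𝓘(ℝ, Cn n) (𝓘(ℝ, Cn n).prod 𝓘(ℝ, Cn n)) ∞
      (fun y => (Bundle.TotalSpace.mk' (Cn n) (e.symm y)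
        (mfderiv 𝓘(ℝ, Cn n) 𝓘(ℝ, Cn n) e.symm y u) :
          Bundle.TotalSpace (Cn n) (fun x : X => TangentSpace 𝓘(ℝ, Cn n) x))) z := by
    have h1 := hsymm.contMDiffOn_tangentMapWithin (m := ∞) (by exact le_top)
      e.open_target.uniqueMDiffOn
    have h2 : ContMDiff 𝓘(ℝ, Cn n) (𝓘(ℝ, Cn n).prod 𝓘(ℝ, Cn n)) ∞
      (fun y => (Bundle.TotalSpace.mk' (Cn n) y u : TangentBundle 𝓘(ℝ, Cn n) (Cn n))) := by
      intro y
      exact (contMDiffAt_vectorSpace_iff_contDiffAt (V := fun _ => u)).2 contDiffAt_const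
    have h3 := h1.comp (h2.contMDiffOn (s := e.target)) (fun y hy => hy)
    refine (h3.contMDiffAt (e.open_target.mem_nhds hz)).congr_of_eventuallyEq ?_
    filter_upwards [e.open_target.mem_nhds hz] with y hy
    simp only [Function.comp, tangentMapWithin]
    rw [mfderivWithin_of_isOpen e.open_target hy]
  have hg : ContMDiffAt 𝓘(ℝ, Cn n) (𝓘(ℝ, Cn n).prod 𝓘(ℝ, Cn n →L[ℝ] Cn n →L[ℝ] ℝ)) ∞
      (fun y => (Bundle.TotalSpace.mk' (Cn n →L[ℝ] Cn n →L[ℝ] ℝ) (e.symm y)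
        (g.inner (e.symm y)) : Bundle.TotalSpace (Cn n →L[ℝ] Cn n →L[ℝ] ℝ)
          (fun x : X => TangentSpace 𝓘(ℝ, Cn n) x →L[ℝ] TangentSpace 𝓘(ℝ, Cn n) x →L[ℝ] ℝ))) z :=
    ContMDiffAt.comp z (g.contMDiff (e.symm z))
      ((hsymm.contMDiffAt (e.open_target.mem_nhds hz)).of_le le_top)
  have key := ContMDiffAt.clm_bundle_apply₂ (F₁ := Cn n) (F₂ := Cn n) (F₃ := ℝ)
    (E₁ := fun x : X => TangentSpace 𝓘(ℝ, Cn n) x)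
    (E₂ := fun x : X => TangentSpace 𝓘(ℝ, Cn n) x)
    (E₃ := Bundle.Trivial X ℝ) hg (hvec u) (hvec w)
  rw [Bundle.contMDiffAt_totalSpace] at key
  exact key.2.contDiffAt

end Geometry

/-! ### The Hermitian matrix of the metric -/

section HermitianForm

open scoped ComplexOrder

variable {n : ℕ} {X : Type*} [TopologicalSpace X] [ChartedSpace (Cn n) X]
  [IsManifold 𝓘(ℂ, Cn n) ω X] (g : HermitianMetric n X) {e : OpenPartialHomeomorph X (Cn n)}

/-- J is an isometry with J² = -1, hence skew-adjoint. -/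
theorem realMetric_I_smul_right (he : e ∈ atlas (Cn n) X) {z : Cn n} (hz : z ∈ e.target)
    (u w : Cn n) :
    realMetric g e z u (Complex.I • w) = -realMetric g e z (Complex.I • u) w := by
  rw [← realMetric_I_smul g he hz u, smul_smul, Complex.I_mul_I,
    show ((-1 : ℂ) • w) = (-1 : ℝ) • w by simp, realMetric_symm, realMetric_smul_left,
    realMetric_symm]
  ring

/-- Twice the Hermitian form of the metric in the chart `e`, on real tangent vectors. -/
noncomputable def hermForm (g : HermitianMetric n X) (e : OpenPartialHomeomorph X (Cn n))
    (z u w : Cn n) : ℂ :=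
  realMetric g e z u w + Complex.I * realMetric g e z u (Complex.I • w)

theorem star_hermForm (he : e ∈ atlas (Cn n) X) {z : Cn n} (hz : z ∈ e.target) (u w : Cn n) :
    star (hermForm g e z u w) = hermForm g e z w u := by
  unfold hermForm
  rw [realMetric_I_smul_right g he hz u w, realMetric_symm g e z _ w]
  simpa using realMetric_symm g e z _ _

theorem hermForm_add_left (z u v w : Cn n) :
    hermForm g e z (u + v) w = hermForm g e z u w + hermForm g e z v w := by
  unfold hermForm
  rw [realMetric_add_left, realMetric_add_left]; push_cast; ring

theorem hermForm_smul_left (he : e ∈ atlas (Cn n) X) {z : Cn n} (hz : z ∈ e.target) (a : ℂ)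
    (u w : Cn n) : hermForm g e z (a • u) w = a * hermForm g e z u w := by
  have ha : a • u = a.re • u + a.im • (Complex.I • u) := by
    conv_lhs => rw [← Complex.re_add_im a]
    rw [add_smul, mul_smul]; simp
  have hI := realMetric_I_smul_right g he hz u w
  have hII := realMetric_I_smul g he hz u w
  unfold hermForm
  rw [ha, realMetric_add_left, realMetric_add_left, realMetric_smul_left, realMetric_smul_left,
    realMetric_smul_left, realMetric_smul_left, hII, hI]
  conv_rhs => rw [← Complex.re_add_im a]
  push_cast
  linear_combination ((a.im : ℂ) * realMetric g e z (Complex.I • u) w) * Complex.I_mul_I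

/-- `hermForm` as a linear map in its first argument. -/
noncomputable def hermFormLin (he : e ∈ atlas (Cn n) X) {z : Cn n} (hz : z ∈ e.target)
    (w : Cn n) : Cn n →ₗ[ℂ] ℂ where
  toFun u := hermForm g e z u w
  map_add' u v := hermForm_add_left g z u v w
  map_smul' a u := hermForm_smul_left g he hz a u w

theorem eq_sum_smul_dx (v : Cn n) : v = ∑ i, v i • dx (Sum.inl i) := by
  ext j
  simp [dx, Pi.single_apply]

theorem hermForm_eq_sum_left (he : e ∈ atlas (Cn n) X) {z : Cn n} (hz : z ∈ e.target)
    (v w : Cn n) : hermForm g e z v w = ∑ i, v i * hermForm g e z (dx (Sum.inl i)) w := by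
  have h : hermFormLin g he hz w v
      = hermFormLin g he hz w (∑ i, v i • dx (Sum.inl i)) := by rw [← eq_sum_smul_dx]
  rw [map_sum] at h
  simpa [hermFormLin, hermForm_smul_left g he hz] using h

theorem hMetric_apply (he : e ∈ atlas (Cn n) X) {z : Cn n} (hz : z ∈ e.target) (i j : Fin n) :
    hMetric g e z i j = (1 / 2) * hermForm g e z (dx (Sum.inl i)) (dx (Sum.inl j)) := by
  have hj : (dx (Sum.inr j) : Cn n) = dx (Sum.inl j) := rfl
  unfold hermForm
  simp only [hMetric, cMetric, Matrix.of_apply, frameCoeff, Sum.elim_inl, Sum.elim_inr, hj]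
  rw [realMetric_I_smul g he hz, realMetric_I_smul_right g he hz]
  push_cast
  linear_combination (-(1 / 4) * (realMetric g e z (dx (Sum.inl i)) (dx (Sum.inl j)) : ℂ)) *
    Complex.I_mul_I

/-- The imaginary part g(v, Jv) of the Hermitian form vanishes on the diagonal since J is skew. This
makes `normSq` real and transfers positivity from g to `hMetric`. -/
theorem hMetric_sum_eq (he : e ∈ atlas (Cn n) X) {z : Cn n} (hz : z ∈ e.target) (v : Cn n) :
    ∑ i, ∑ j, hMetric g e z i j * v i * star (v j) = (1 / 2) * realMetric g e z v v := by
  have h1 : hermForm g e z v v = realMetric g e z v v := by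
    have h := realMetric_I_smul_right g he hz v v
    rw [realMetric_symm g e z (Complex.I • v) v] at h
    have h0 : realMetric g e z v (Complex.I • v) = 0 := by linarith
    simp [hermForm, h0]
  rw [← h1, hermForm_eq_sum_left g he hz, Finset.mul_sum]
  refine Finset.sum_congr rfl fun i _ => ?_
  rw [← star_hermForm g he hz v, hermForm_eq_sum_left g he hz, star_sum, Finset.mul_sum,
    Finset.mul_sum]
  refine Finset.sum_congr rfl fun j _ => ?_
  rw [star_mul', star_hermForm g he hz, hMetric_apply g he hz]
  ring

theorem hMetric_isHermitian (he : e ∈ atlas (Cn n) X) {z : Cn n} (hz : z ∈ e.target) :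
    (hMetric g e z).IsHermitian := by
  ext i j
  rw [Matrix.conjTranspose_apply, hMetric_apply g he hz, hMetric_apply g he hz, star_mul',
    star_hermForm g he hz]
  simp

theorem hMetric_posDef (he : e ∈ atlas (Cn n) X) {z : Cn n} (hz : z ∈ e.target) :
    (hMetric g e z).PosDef := by
  refine Matrix.PosDef.of_dotProduct_mulVec_pos (hMetric_isHermitian g he hz) fun x hx => ?_
  -- The matrix form x̄ᵀHx conjugates the row vector, whereas `hMetric_sum_eq` conjugates the column
  -- index; hence v = x̄.
  have hx' : (WithLp.toLp 2 (star x) : Cn n) ≠ 0 := fun h => hx (by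
    have := congrArg WithLp.ofLp h
    simpa using this)
  have h := hMetric_sum_eq g he hz (WithLp.toLp 2 (star x))
  have h2 : star x ⬝ᵥ (hMetric g e z) *ᵥ x
      = ((1 / 2 * realMetric g e z (WithLp.toLp 2 (star x)) (WithLp.toLp 2 (star x)) : ℝ) : ℂ) := by
    push_cast
    rw [← h]
    simp only [dotProduct, Matrix.mulVec, Finset.mul_sum, Pi.star_apply, star_star]
    refine Finset.sum_congr rfl fun i _ => Finset.sum_congr rfl fun j _ => ?_
    ring
  rw [h2, Complex.zero_lt_real]
  have := realMetric_pos g he hz hx'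
  positivity

/-- J acts by i on T^{1,0} and by -i on T^{0,1}, so J-invariance makes each isotropic for the
bilinear extension. -/
theorem cMetric_eq_fromBlocks (he : e ∈ atlas (Cn n) X) {z : Cn n} (hz : z ∈ e.target) :
    cMetric g e z = Matrix.fromBlocks 0 (hMetric g e z) (hMetric g e z)ᵀ 0 := by
  have hj (j : Fin n) : (dx (Sum.inr j) : Cn n) = dx (Sum.inl j) := rfl
  ext A B
  rcases A with i | i <;> rcases B with j | j
  · simp only [cMetric, Matrix.of_apply, frameCoeff, Sum.elim_inl, Matrix.fromBlocks_apply₁₁,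
      Matrix.zero_apply]
    rw [realMetric_I_smul g he hz, realMetric_I_smul_right g he hz]
    push_cast
    linear_combination ((1 / 4) * (realMetric g e z (dx (Sum.inl i)) (dx (Sum.inl j)) : ℂ)) *
      Complex.I_mul_I
  · rfl
  · simp only [cMetric, hMetric, Matrix.of_apply, frameCoeff, Sum.elim_inl, Sum.elim_inr,
      Matrix.fromBlocks_apply₂₁, Matrix.transpose_apply, hj]
    rw [realMetric_symm g e z (dx (Sum.inl i)) (dx (Sum.inl j)),
      realMetric_symm g e z (dx (Sum.inl i)) (Complex.I • dx (Sum.inl j)),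
      realMetric_symm g e z (Complex.I • dx (Sum.inl i)) (dx (Sum.inl j)),
      realMetric_symm g e z (Complex.I • dx (Sum.inl i)) (Complex.I • dx (Sum.inl j))]
    ring
  · simp only [cMetric, Matrix.of_apply, frameCoeff, Sum.elim_inr, Matrix.fromBlocks_apply₂₂,
      Matrix.zero_apply, hj]
    rw [realMetric_I_smul g he hz, realMetric_I_smul_right g he hz]
    push_cast
    linear_combination ((1 / 4) * (realMetric g e z (dx (Sum.inl i)) (dx (Sum.inl j)) : ℂ)) *
      Complex.I_mul_I

theorem contDiffAt_hMetric (he : e ∈ atlas (Cn n) X) {z : Cn n} (hz : z ∈ e.target)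
    (i j : Fin n) : ContDiffAt ℝ ∞ (fun y => hMetric g e y i j) z := by
  have h (u w : Cn n) : ContDiffAt ℝ ∞ (fun y => (realMetric g e y u w : ℂ)) z :=
    Complex.ofRealCLM.contDiff.contDiffAt.comp z (contDiffAt_realMetric g he hz u w)
  simp only [hMetric, cMetric, Matrix.of_apply]
  exact contDiffAt_const.mul ((((h _ _).add (contDiffAt_const.mul (h _ _))).add
    (contDiffAt_const.mul (h _ _))).add (contDiffAt_const.mul (h _ _)))

end HermitianForm

/-! ### Calculus of Wirtinger derivatives -/

section Wirtinger

open Filter Topology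

variable {n : ℕ} {f f' : Cn n → ℂ} {z : Cn n}

theorem wirtinger_congr (A : Idx n) (h : f =ᶠ[𝓝 z] f') : wirtinger A f z = wirtinger A f' z := by
  rw [wirtinger, wirtinger, h.fderiv_eq]

theorem wirtinger_const (A : Idx n) (c : ℂ) : wirtinger A (fun _ => c) z = 0 := by
  simp [wirtinger]

theorem wirtinger_neg (A : Idx n) : wirtinger A (fun y => -f y) z = -wirtinger A f z := by
  simp only [wirtinger, fderiv_fun_neg, neg_apply]; ring

theorem wirtinger_add (A : Idx n) (hf : DifferentiableAt ℝ f z) (hf' : DifferentiableAt ℝ f' z) :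
    wirtinger A (fun y => f y + f' y) z = wirtinger A f z + wirtinger A f' z := by
  simp only [wirtinger, fderiv_fun_add hf hf', add_apply]; ring

theorem wirtinger_mul (A : Idx n) (hf : DifferentiableAt ℝ f z) (hf' : DifferentiableAt ℝ f' z) :
    wirtinger A (fun y => f y * f' y) z
      = wirtinger A f z * f' z + f z * wirtinger A f' z := by
  simp only [wirtinger, fderiv_fun_mul hf hf', add_apply,
    smul_apply, smul_eq_mul]; ring

theorem wirtinger_const_mul (A : Idx n) (c : ℂ) (hf : DifferentiableAt ℝ f z) :
    wirtinger A (fun y => c * f y) z = c * wirtinger A f z := by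
  rw [wirtinger_mul A (differentiableAt_const c) hf, wirtinger_const, zero_mul, zero_add]

theorem wirtinger_sum {ι : Type*} (A : Idx n) (s : Finset ι) {F : ι → Cn n → ℂ}
    (hF : ∀ i ∈ s, DifferentiableAt ℝ (F i) z) :
    wirtinger A (fun y => ∑ i ∈ s, F i y) z = ∑ i ∈ s, wirtinger A (F i) z := by
  simp only [wirtinger, fderiv_fun_sum hF, sum_apply, Finset.mul_sum,
    ← Finset.sum_add_distrib]

theorem star_wirtinger (A : Idx n) (f : Cn n → ℂ) (z : Cn n) :
    star (wirtinger A f z) = wirtinger A.swap (fun y => star (f y)) z := by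
  have h : fderiv ℝ (fun y => star (f y)) z
      = (Complex.conjCLE : ℂ →L[ℝ] ℂ).comp (fderiv ℝ f z) :=
    Complex.conjCLE.comp_fderiv (f := f) (x := z)
  have hd : (dx A.swap : Cn n) = dx A := by rcases A with i | i <;> rfl
  have hc : frameCoeff A.swap = star (frameCoeff A) := by
    rcases A with i | i <;> simp [frameCoeff]
  simp only [wirtinger, h, hd, hc, ContinuousLinearMap.comp_apply, star_mul', star_add]
  simp

theorem contDiffAt_wirtinger (A : Idx n) (hf : ContDiffAt ℝ ∞ f z) :
    ContDiffAt ℝ ∞ (wirtinger A f) z := by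
  have h : ContDiffAt ℝ ∞ (fderiv ℝ f) z := hf.fderiv_right (by exact le_rfl)
  exact contDiffAt_const.mul ((h.clm_apply contDiffAt_const).add
    (contDiffAt_const.mul (h.clm_apply contDiffAt_const)))

/-- Wirtinger derivatives commute. -/
theorem wirtinger_comm (A B : Idx n) (hf : ContDiffAt ℝ ∞ f z) :
    wirtinger A (wirtinger B f) z = wirtinger B (wirtinger A f) z := by
  have h : ContDiffAt ℝ ∞ (fderiv ℝ f) z := hf.fderiv_right (by exact le_rfl)
  have hd : DifferentiableAt ℝ (fderiv ℝ f) z := h.differentiableAt (by simp)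
  have hu (u : Cn n) : DifferentiableAt ℝ (fun y => fderiv ℝ f y u) z :=
    hd.clm_apply (differentiableAt_const u)
  have hsymm (u w : Cn n) : fderiv ℝ (fderiv ℝ f) z u w = fderiv ℝ (fderiv ℝ f) z w u :=
    (hf.isSymmSndFDerivAt (by
      rw [minSmoothness_of_isRCLikeNormedField]
      exact WithTop.coe_le_coe.2 (le_top : (2 : ℕ∞) ≤ ⊤))) u w
  have h1 (A : Idx n) (u : Cn n) : wirtinger A (fun y => fderiv ℝ f y u) z
      = (1 / 2) * (fderiv ℝ (fderiv ℝ f) z (dx A) u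
        + frameCoeff A * fderiv ℝ (fderiv ℝ f) z (Complex.I • dx A) u) := by
    have h2 (w : Cn n) :
        fderiv ℝ (fun y => fderiv ℝ f y u) z w = fderiv ℝ (fderiv ℝ f) z w u := by
      rw [fderiv_clm_apply hd (differentiableAt_const u)]; simp
    rw [wirtinger, h2, h2]
  have h3 (A B : Idx n) : wirtinger A (wirtinger B f) z
      = (1 / 2) * (wirtinger A (fun y => fderiv ℝ f y (dx B)) z
        + frameCoeff B * wirtinger A (fun y => fderiv ℝ f y (Complex.I • dx B)) z) := by
    rw [← wirtinger_const_mul A _ (hu _), ← wirtinger_add A (hu _) ((hu _).const_mul _),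
      ← wirtinger_const_mul A _ ((hu _).fun_add ((hu _).const_mul _))]
    rfl
  rw [h3, h3, h1, h1, h1, h1, hsymm (dx A) (dx B), hsymm (dx A) (Complex.I • dx B),
    hsymm (Complex.I • dx A) (dx B), hsymm (Complex.I • dx A) (Complex.I • dx B)]
  ring

theorem wirtingerMatrix_congr {M N : Cn n → Matrix (Fin n) (Fin n) ℂ} (A : Idx n)
    (h : M =ᶠ[𝓝 z] N) : wirtingerMatrix A M z = wirtingerMatrix A N z := by
  ext j k
  exact wirtinger_congr A (h.mono fun y hy => by simp only [hy])

theorem wirtingerMatrix_mul {M N : Cn n → Matrix (Fin n) (Fin n) ℂ} (A : Idx n)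
    (hM : ∀ i j, DifferentiableAt ℝ (fun y => M y i j) z)
    (hN : ∀ i j, DifferentiableAt ℝ (fun y => N y i j) z) :
    wirtingerMatrix A (fun y => M y * N y) z
      = wirtingerMatrix A M z * N z + M z * wirtingerMatrix A N z := by
  ext j k
  simp only [wirtingerMatrix, Matrix.of_apply, Matrix.mul_apply, Matrix.add_apply]
  rw [wirtinger_sum A _ fun i _ => (hM j i).fun_mul (hN i k), ← Finset.sum_add_distrib]
  exact Finset.sum_congr rfl fun i _ => wirtinger_mul A (hM j i) (hN i k)

theorem wirtingerMatrix_add_smul {M N : Cn n → Matrix (Fin n) (Fin n) ℂ} (A : Idx n) (c : ℂ)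
    (hM : ∀ i j, DifferentiableAt ℝ (fun y => M y i j) z)
    (hN : ∀ i j, DifferentiableAt ℝ (fun y => N y i j) z) :
    wirtingerMatrix A (fun y => M y + c • N y) z
      = wirtingerMatrix A M z + c • wirtingerMatrix A N z := by
  ext j k
  simp only [wirtingerMatrix, Matrix.of_apply, Matrix.smul_apply, Matrix.add_apply, smul_eq_mul]
  rw [wirtinger_add A (hM j k) ((hN j k).const_mul c), wirtinger_const_mul A c (hN j k)]

theorem contDiffAt_det {m : ℕ} {M : Cn n → Matrix (Fin m) (Fin m) ℂ}
    (hM : ∀ i j, ContDiffAt ℝ ∞ (fun y => M y i j) z) :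
    ContDiffAt ℝ ∞ (fun y => (M y).det) z := by
  simp only [Matrix.det_apply']
  exact ContDiffAt.sum fun σ _ => contDiffAt_const.mul (contDiffAt_prod fun i _ => hM _ _)

/-- The inverse is adjugate over determinant, and each adjugate entry is the determinant of the
matrix with one row replaced by a constant row. -/
theorem contDiffAt_matrix_inv {m : ℕ} {M : Cn n → Matrix (Fin m) (Fin m) ℂ}
    (hM : ∀ i j, ContDiffAt ℝ ∞ (fun y => M y i j) z) (h0 : (M z).det ≠ 0) (i j : Fin m) :
    ContDiffAt ℝ ∞ (fun y => (M y)⁻¹ i j) z := by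
  simp only [Matrix.inv_def, Matrix.smul_apply, Ring.inverse_eq_inv', smul_eq_mul,
    Matrix.adjugate_apply]
  refine ((contDiffAt_det hM).inv h0).mul (contDiffAt_det fun k l => ?_)
  by_cases hk : k = j
  · subst hk; simpa using contDiffAt_const
  · simpa [Matrix.updateRow_ne hk] using hM k l

theorem contDiffAt_matrix_mul {m : ℕ} {M N : Cn n → Matrix (Fin m) (Fin m) ℂ}
    (hM : ∀ i j, ContDiffAt ℝ ∞ (fun y => M y i j) z)
    (hN : ∀ i j, ContDiffAt ℝ ∞ (fun y => N y i j) z) (i j : Fin m) :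
    ContDiffAt ℝ ∞ (fun y => (M y * N y) i j) z := by
  simp only [Matrix.mul_apply]
  exact ContDiffAt.sum fun k _ => (hM i k).mul (hN k j)

end Wirtinger

/-! ### Symmetries and positivity of the contraction -/

section Contraction

variable {n : ℕ}

/-- The contraction `∑ T_{i j̄ k l̄} vᵢ v̄ⱼ vₖ v̄ₗ`. -/
noncomputable def contract (T : Fin n → Fin n → Matrix (Fin n) (Fin n) ℂ) (v : Cn n) : ℂ :=
  ∑ i, ∑ j, ∑ k, ∑ l, T i j k l * v i * star (v j) * v k * star (v l)

variable (S T : Fin n → Fin n → Matrix (Fin n) (Fin n) ℂ) (v : Cn n)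

theorem contract_add : contract (fun i j => S i j + T i j) v = contract S v + contract T v := by
  simp only [contract, Matrix.add_apply, add_mul, Finset.sum_add_distrib]

theorem contract_smul (c : ℂ) : contract (fun i j => c • T i j) v = c * contract T v := by
  simp only [contract, Matrix.smul_apply, smul_eq_mul, Finset.mul_sum, mul_assoc]

variable {S T}

/-- The weight v_i v_k is symmetric in i and k, so exchanging them shows the sum equals its own
negative. -/
theorem contract_eq_zero_of_antisymm_left (h : ∀ i j k l, T i j k l = -T k j i l) :
    contract T v = 0 := by
  have h1 : contract T v = -contract T v := by
    conv_lhs =>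
      rw [contract, Finset.sum_comm]
      enter [2, j]
      rw [Finset.sum_comm]
    rw [contract, Finset.sum_comm, ← Finset.sum_neg_distrib]
    refine Finset.sum_congr rfl fun j _ => ?_
    rw [← Finset.sum_neg_distrib]
    refine Finset.sum_congr rfl fun k _ => ?_
    rw [← Finset.sum_neg_distrib]
    refine Finset.sum_congr rfl fun i _ => ?_
    rw [← Finset.sum_neg_distrib]
    refine Finset.sum_congr rfl fun l _ => ?_
    rw [h]; ring
  exact self_eq_neg.1 h1

theorem contract_star (h : ∀ i j, T i j = (S j i)ᴴ) : star (contract S v) = contract T v := by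
  simp only [contract, star_sum, star_mul', star_star]
  rw [Finset.sum_comm]
  refine Finset.sum_congr rfl fun i _ => Finset.sum_congr rfl fun j _ => ?_
  rw [Finset.sum_comm]
  refine Finset.sum_congr rfl fun k _ => Finset.sum_congr rfl fun l _ => ?_
  rw [h, Matrix.conjTranspose_apply]; ring

/-- Conjugate transposition exchanges the holomorphic and antiholomorphic slots, reducing to the
left case. -/
theorem contract_eq_zero_of_antisymm_right (h : ∀ i j k l, T i j k l = -T i l k j) :
    contract T v = 0 := by
  rw [← star_eq_zero, contract_star v (T := fun i j => (T j i)ᴴ) fun _ _ => rfl]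
  refine contract_eq_zero_of_antisymm_left v fun i j k l => ?_
  simp only [Matrix.conjTranspose_apply]
  rw [h, star_neg]

theorem contract_im_eq_zero (h : ∀ i j, T i j = (T j i)ᴴ) : (contract T v).im = 0 :=
  Complex.conj_eq_iff_im.1 (contract_star v h)

-- The contraction equals wᴴ K w for the vector w_b = ∑ P_i(b, l) v_i v̄_l.
open scoped ComplexOrder in
theorem contract_conjTranspose_mul_mul_nonneg {K : Matrix (Fin n) (Fin n) ℂ} (hK : K.PosSemidef)
    (P : Fin n → Matrix (Fin n) (Fin n) ℂ) :
    0 ≤ contract (fun i j => (P j)ᴴ * K * P i) v := by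
  have h := hK.dotProduct_mulVec_nonneg (fun b => ∑ i, ∑ l, P i b l * v i * star (v l))
  convert h using 1
  simp only [contract, dotProduct, Matrix.mulVec, Matrix.mul_apply, Pi.star_apply, star_sum,
    star_mul', star_star, Matrix.conjTranspose_apply, Finset.mul_sum, Finset.sum_mul]
  -- Both sides expand to the same sixfold sum in different orders; this permutation aligns them.
  have key (F : Fin n → Fin n → Fin n → Fin n → Fin n → Fin n → ℂ) :
      ∑ i, ∑ j, ∑ k, ∑ l, ∑ b, ∑ a, F i j k l a b
        = ∑ a, ∑ b, ∑ i, ∑ l, ∑ j, ∑ k, F i j k l a b := by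
    simp only [← Fintype.sum_prod_type']
    refine Fintype.sum_equiv
      { toFun := fun p => (p.2.2.2.2.2, p.2.2.2.2.1, p.1, p.2.2.2.1, p.2.1, p.2.2.1)
        invFun := fun q => (q.2.2.1, q.2.2.2.2.1, q.2.2.2.2.2, q.2.2.2.1, q.2.1, q.1)
        left_inv := fun _ => rfl
        right_inv := fun _ => rfl } _ _ fun _ => rfl
  rw [key]
  refine Finset.sum_congr rfl fun a _ => Finset.sum_congr rfl fun b _ =>
    Finset.sum_congr rfl fun i _ => Finset.sum_congr rfl fun l _ =>
    Finset.sum_congr rfl fun j _ => Finset.sum_congr rfl fun k _ => ?_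
  ring

end Contraction

/-! ### Connection matrices in terms of torsion -/

section Connection

open Filter Topology

variable {n : ℕ}

/-- The torsion matrices `(∂ⱼ h_{i d̄} - ∂ᵢ h_{j d̄})_{j d}`. -/
noncomputable def torsion (H : Cn n → Matrix (Fin n) (Fin n) ℂ) (i : Fin n) (z : Cn n) :
    Matrix (Fin n) (Fin n) ℂ :=
  Matrix.of fun j d => wirtinger (Sum.inl j) (fun y => H y i d) z
    - wirtinger (Sum.inl i) (fun y => H y j d) z

/-- The conjugate torsion matrices `(∂_{ī} h_{j d̄} - ∂_{d̄} h_{j ī})_{j d}`. -/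
noncomputable def cotorsion (H : Cn n → Matrix (Fin n) (Fin n) ℂ) (i : Fin n) (z : Cn n) :
    Matrix (Fin n) (Fin n) ℂ :=
  Matrix.of fun j d => wirtinger (Sum.inr i) (fun y => H y j d) z
    - wirtinger (Sum.inr d) (fun y => H y j i) z

variable {X : Type*} [TopologicalSpace X] [ChartedSpace (Cn n) X]
  [IsManifold 𝓘(ℂ, Cn n) ω X] (g : HermitianMetric n X) {e : OpenPartialHomeomorph X (Cn n)}

open scoped ComplexOrder in
theorem isUnit_det_hMetric (he : e ∈ atlas (Cn n) X) {z : Cn n} (hz : z ∈ e.target) :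
    IsUnit (hMetric g e z).det :=
  isUnit_iff_ne_zero.2 (hMetric_posDef g he hz).det_pos.ne'

theorem inv_cMetric (he : e ∈ atlas (Cn n) X) {z : Cn n} (hz : z ∈ e.target) :
    (cMetric g e z)⁻¹ = Matrix.fromBlocks 0 ((hMetric g e z)ᵀ)⁻¹ (hMetric g e z)⁻¹ 0 := by
  have h := isUnit_det_hMetric g he hz
  refine Matrix.inv_eq_right_inv ?_
  rw [cMetric_eq_fromBlocks g he hz, Matrix.fromBlocks_multiply, Matrix.mul_nonsing_inv _ h,
    Matrix.mul_nonsing_inv _ (by rwa [Matrix.det_transpose])]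
  simp

theorem wirtinger_cMetric (he : e ∈ atlas (Cn n) X) {z : Cn n} (hz : z ∈ e.target)
    (A B C : Idx n) : wirtinger A (fun y => cMetric g e y B C) z
      = wirtinger A (fun y =>
          Matrix.fromBlocks 0 (hMetric g e y) (hMetric g e y)ᵀ 0 B C) z := by
  refine wirtinger_congr A ?_
  filter_upwards [e.open_target.mem_nhds hz] with y hy
  rw [cMetric_eq_fromBlocks g he hy]

/-- The inverse metric pairs a (1,0) index only with (0,1) indices d̄, and ∂_{d̄} g_{ij} = 0. What
remains, (∂_i h_{jd̄} + ∂_j h_{id̄})/2, is the Chern term plus half the torsion. -/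
theorem lichnerowicz_inl (he : e ∈ atlas (Cn n) X) {z : Cn n} (hz : z ∈ e.target) (i : Fin n) :
    lichnerowicz g e z (Sum.inl i)
      = (wirtingerMatrix (Sum.inl i) (hMetric g e) z
          + (1 / 2 : ℂ) • torsion (hMetric g e) i z) * (hMetric g e z)⁻¹ := by
  ext j k
  simp only [lichnerowicz, Matrix.of_apply, leviCivita, wirtinger_cMetric g he hz,
    inv_cMetric g he hz, Fintype.sum_sum_type, Matrix.mul_apply, Matrix.add_apply,
    Matrix.smul_apply, smul_eq_mul, torsion, wirtingerMatrix, Matrix.fromBlocks_apply₁₁,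
    Matrix.fromBlocks_apply₁₂, Matrix.fromBlocks_apply₂₁, Matrix.zero_apply, wirtinger_const,
    mul_zero, Finset.sum_const_zero, zero_add, sub_zero, Finset.mul_sum]
  exact Finset.sum_congr rfl fun d _ => by ring

theorem lichnerowicz_inr (he : e ∈ atlas (Cn n) X) {z : Cn n} (hz : z ∈ e.target) (i : Fin n) :
    lichnerowicz g e z (Sum.inr i)
      = ((1 / 2 : ℂ) • cotorsion (hMetric g e) i z) * (hMetric g e z)⁻¹ := by
  ext j k
  simp only [lichnerowicz, Matrix.of_apply, leviCivita, wirtinger_cMetric g he hz,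
    inv_cMetric g he hz, Fintype.sum_sum_type, Matrix.mul_apply,
    Matrix.smul_apply, smul_eq_mul, cotorsion, Matrix.fromBlocks_apply₁₁,
    Matrix.fromBlocks_apply₁₂, Matrix.fromBlocks_apply₂₁, Matrix.fromBlocks_apply₂₂,
    Matrix.zero_apply, wirtinger_const, Matrix.transpose_apply,
    mul_zero, Finset.sum_const_zero, zero_add, add_zero, Finset.mul_sum]
  exact Finset.sum_congr rfl fun d _ => by ring

theorem gauduchon_inl (t : ℝ) (he : e ∈ atlas (Cn n) X) {z : Cn n} (hz : z ∈ e.target)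
    (i : Fin n) : gauduchon g t e z (Sum.inl i)
      = (wirtingerMatrix (Sum.inl i) (hMetric g e) z
          + ((1 - t) / 2 : ℂ) • torsion (hMetric g e) i z) * (hMetric g e z)⁻¹ := by
  rw [gauduchon, lichnerowicz_inl g he hz, chern, Sum.elim_inl, ← Matrix.smul_mul,
    ← Matrix.smul_mul, ← Matrix.add_mul]
  congr 1
  push_cast
  module

theorem gauduchon_inr (t : ℝ) (he : e ∈ atlas (Cn n) X) {z : Cn n} (hz : z ∈ e.target)
    (i : Fin n) : gauduchon g t e z (Sum.inr i)
      = (((1 - t) / 2 : ℂ) • cotorsion (hMetric g e) i z) * (hMetric g e z)⁻¹ := by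
  rw [gauduchon, lichnerowicz_inr g he hz, chern, Sum.elim_inr, smul_zero, zero_add,
    ← Matrix.smul_mul, smul_smul]
  congr 2
  push_cast
  ring

/-- Lets the Chern curvature be read off at t = 1 from the formula for general t. -/
theorem gauduchon_one : gauduchon g 1 = chern g := by
  funext e z A
  simp [gauduchon]

end Connection

/-! ### Comparison of Gauduchon and Chern curvature -/

section Curvature

open Filter Topology

variable {n : ℕ}

/-- The curvature of a connection with connection matrices `S * H⁻¹`, lowered with `H`. -/
theorem curvature_mul {θ S : ConnForm n} {H : Cn n → Matrix (Fin n) (Fin n) ℂ} {z : Cn n}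
    (A B : Idx n) (hθ : ∀ A, (fun y => θ y A) =ᶠ[𝓝 z] fun y => S y A * (H y)⁻¹)
    (hS : ∀ A i j, ContDiffAt ℝ ∞ (fun y => S y A i j) z)
    (hH : ∀ i j, ContDiffAt ℝ ∞ (fun y => H y i j) z)
    (hdet : ∀ᶠ y in 𝓝 z, IsUnit (H y).det) :
    curvature θ z A B * H z
      = wirtingerMatrix A (fun y => S y B) z - wirtingerMatrix B (fun y => S y A) z
        + S z B * (H z)⁻¹ * (S z A - wirtingerMatrix A H z)
        + S z A * (H z)⁻¹ * (wirtingerMatrix B H z - S z B) := by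
  have hz := hdet.self_of_nhds
  have hinv := contDiffAt_matrix_inv hH hz.ne_zero
  have hd (A : Idx n) (i j : Fin n) : DifferentiableAt ℝ (fun y => (S y A * (H y)⁻¹) i j) z :=
    (contDiffAt_matrix_mul (hS A) hinv i j).differentiableAt (by simp)
  -- Leibniz applied to S = θH avoids an explicit formula for the derivative of H⁻¹.
  have key (A B : Idx n) : wirtingerMatrix A (fun y => S y B) z
      = wirtingerMatrix A (fun y => θ y B) z * H z
        + S z B * (H z)⁻¹ * wirtingerMatrix A H z := by
    rw [wirtingerMatrix_congr A (hθ B), ← wirtingerMatrix_mul A (hd B)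
      fun i j => (hH i j).differentiableAt (by simp)]
    refine wirtingerMatrix_congr A ?_
    filter_upwards [hdet] with y hy
    rw [Matrix.mul_assoc, Matrix.nonsing_inv_mul _ hy, Matrix.mul_one]
  have hθz (A : Idx n) : θ z A = S z A * (H z)⁻¹ := (hθ A).self_of_nhds
  have hθH (A : Idx n) : S z A * (H z)⁻¹ * H z = S z A := by
    rw [Matrix.mul_assoc, Matrix.nonsing_inv_mul _ hz, Matrix.mul_one]
  rw [key A B, key B A, curvature, hθz, hθz]
  have h3 (A B : Idx n) : S z B * (H z)⁻¹ * (S z A * (H z)⁻¹) * H z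
      = S z B * (H z)⁻¹ * S z A := by rw [Matrix.mul_assoc, hθH]
  simp only [Matrix.add_mul, Matrix.sub_mul, Matrix.mul_sub, h3]
  abel

variable {X : Type*} [TopologicalSpace X] [ChartedSpace (Cn n) X]
  [IsManifold 𝓘(ℂ, Cn n) ω X] (g : HermitianMetric n X) {e : OpenPartialHomeomorph X (Cn n)}

theorem contDiffAt_torsion {H : Cn n → Matrix (Fin n) (Fin n) ℂ} {z : Cn n}
    (hH : ∀ i j, ContDiffAt ℝ ∞ (fun y => H y i j) z) (i j d : Fin n) :
    ContDiffAt ℝ ∞ (fun y => torsion H i y j d) z :=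
  (contDiffAt_wirtinger _ (hH i d)).sub (contDiffAt_wirtinger _ (hH j d))

theorem contDiffAt_cotorsion {H : Cn n → Matrix (Fin n) (Fin n) ℂ} {z : Cn n}
    (hH : ∀ i j, ContDiffAt ℝ ∞ (fun y => H y i j) z) (i j d : Fin n) :
    ContDiffAt ℝ ∞ (fun y => cotorsion H i y j d) z :=
  (contDiffAt_wirtinger _ (hH j d)).sub (contDiffAt_wirtinger _ (hH j i))

theorem conjTranspose_wirtingerMatrix (he : e ∈ atlas (Cn n) X) {z : Cn n} (hz : z ∈ e.target)
    (A : Idx n) : (wirtingerMatrix A (hMetric g e) z)ᴴ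
      = wirtingerMatrix A.swap (hMetric g e) z := by
  ext j k
  rw [Matrix.conjTranspose_apply]
  simp only [wirtingerMatrix, Matrix.of_apply]
  rw [star_wirtinger]
  refine wirtinger_congr _ ?_
  filter_upwards [e.open_target.mem_nhds hz] with y hy
  exact (hMetric_isHermitian g he hy).apply j k

/-- Conjugation swaps ∂ and ∂̄ and H is Hermitian. The minus sign is what makes the quadratic
torsion term in the curvature nonpositive. -/
theorem cotorsion_eq (he : e ∈ atlas (Cn n) X) {z : Cn n} (hz : z ∈ e.target) (i : Fin n) :
    cotorsion (hMetric g e) i z = -(torsion (hMetric g e) i z)ᴴ := by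
  ext j d
  have h (A : Idx n) (k l : Fin n) := congrFun (congrFun
    (conjTranspose_wirtingerMatrix g he hz A) k) l
  simp only [Matrix.conjTranspose_apply, wirtingerMatrix, Matrix.of_apply] at h
  simp only [cotorsion, torsion, Matrix.neg_apply, Matrix.conjTranspose_apply, Matrix.of_apply,
    star_sub, h, Sum.swap_inl]
  ring

/-- The Chern curvature tensor `-∂_{j̄}∂ᵢ h + ∂ᵢ h · h⁻¹ · ∂_{j̄} h`. -/
noncomputable def chernTensor (H : Cn n → Matrix (Fin n) (Fin n) ℂ) (z : Cn n) (i j : Fin n) :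
    Matrix (Fin n) (Fin n) ℂ :=
  wirtingerMatrix (Sum.inl i) H z * (H z)⁻¹ * wirtingerMatrix (Sum.inr j) H z
    - wirtingerMatrix (Sum.inr j) (wirtingerMatrix (Sum.inl i) H) z

/-- Mixed derivatives commute and H is Hermitian; this symmetry makes the Chern contraction real. -/
theorem chernTensor_eq_conjTranspose (he : e ∈ atlas (Cn n) X) {z : Cn n} (hz : z ∈ e.target)
    (i j : Fin n) :
    chernTensor (hMetric g e) z i j = (chernTensor (hMetric g e) z j i)ᴴ := by
  have h2 : (wirtingerMatrix (Sum.inr i) (wirtingerMatrix (Sum.inl j) (hMetric g e)) z)ᴴ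
      = wirtingerMatrix (Sum.inr j) (wirtingerMatrix (Sum.inl i) (hMetric g e)) z := by
    ext k l
    simp only [Matrix.conjTranspose_apply, wirtingerMatrix, Matrix.of_apply]
    rw [star_wirtinger]
    refine Eq.trans (wirtinger_congr _ ?_) (wirtinger_comm _ _ (contDiffAt_hMetric g he hz k l))
    filter_upwards [e.open_target.mem_nhds hz] with y hy
    exact congrFun (congrFun (conjTranspose_wirtingerMatrix g he hy (Sum.inl j)) k) l
  rw [chernTensor, chernTensor, Matrix.conjTranspose_sub, h2, Matrix.conjTranspose_mul,
    Matrix.conjTranspose_mul, conjTranspose_wirtingerMatrix g he hz,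
    conjTranspose_wirtingerMatrix g he hz, (hMetric_isHermitian g he hz).inv.eq,
    Matrix.mul_assoc]
  rfl

theorem torsion_antisymm (H : Cn n → Matrix (Fin n) (Fin n) ℂ) (z : Cn n) (i j d : Fin n) :
    torsion H i z j d = -torsion H j z i d := by
  simp [torsion]

theorem cotorsion_antisymm (H : Cn n → Matrix (Fin n) (Fin n) ℂ) (z : Cn n) (i j d : Fin n) :
    cotorsion H i z j d = -cotorsion H d z j i := by
  simp [cotorsion]

/-- The contracted `t`-Gauduchon curvature differs from the contracted Chern curvature by a
nonpositive multiple of the squared norm of the torsion. -/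
theorem contract_gauduchon (t : ℝ) (he : e ∈ atlas (Cn n) X) {z : Cn n} (hz : z ∈ e.target)
    (v : Cn n) :
    contract (curvatureTensor g e (gauduchon g t e) z) v
      = contract (chernTensor (hMetric g e) z) v
        - ((1 - t) / 2 : ℂ) ^ 2 * contract (fun i j => (torsion (hMetric g e) j z)ᴴ
            * (hMetric g e z)⁻¹ * torsion (hMetric g e) i z) v := by
  set H := hMetric g e with hHdef
  set c : ℂ := (1 - t) / 2 with hc
  have hH := contDiffAt_hMetric g he hz
  have hnhds := e.open_target.mem_nhds hz
  -- The connection matrices lowered with H, so that θ = S H⁻¹.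
  let S : ConnForm n := fun y A => Sum.elim
    (fun i => wirtingerMatrix (Sum.inl i) H y + c • torsion H i y) (fun i => c • cotorsion H i y) A
  have hW (A : Idx n) (i j : Fin n) : ContDiffAt ℝ ∞ (fun y => wirtingerMatrix A H y i j) z :=
    contDiffAt_wirtinger A (hH i j)
  have hcurv (i j : Fin n) := curvature_mul (θ := gauduchon g t e) (S := S) (H := H)
    (Sum.inl i) (Sum.inr j)
    (fun A => by
      filter_upwards [hnhds] with y hy
      rcases A with i | i
      · exact gauduchon_inl g t he hy i
      · exact gauduchon_inr g t he hy i)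
    (fun A i j => by
      rcases A with k | k
      · exact (hW _ i j).add (contDiffAt_const.mul (contDiffAt_torsion hH k i j))
      · exact contDiffAt_const.mul (contDiffAt_cotorsion hH k i j))
    hH (by filter_upwards [hnhds] with y hy using isUnit_det_hMetric g he hy)
  have h1 (i j : Fin n) : wirtingerMatrix (Sum.inl i) (fun y => S y (Sum.inr j)) z
      = c • wirtingerMatrix (Sum.inl i) (cotorsion H j) z := by
    ext k l
    exact wirtinger_const_mul _ c ((contDiffAt_cotorsion hH j k l).differentiableAt (by simp))
  have h2 (i j : Fin n) : wirtingerMatrix (Sum.inr j) (fun y => S y (Sum.inl i)) z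
      = wirtingerMatrix (Sum.inr j) (wirtingerMatrix (Sum.inl i) H) z
        + c • wirtingerMatrix (Sum.inr j) (torsion H i) z :=
    wirtingerMatrix_add_smul _ c (fun k l => (hW _ k l).differentiableAt (by simp))
      fun k l => (contDiffAt_torsion hH i k l).differentiableAt (by simp)
  -- The terms are grouped so that each one after the first two carries a single antisymmetry: in
  -- (i, k) when `torsion` has the free indices, in (j, l) when `cotorsion` does. The quadratic
  -- product of `torsion` followed by `cotorsion` falls under the former.
  have hexp : curvatureTensor g e (gauduchon g t e) z = fun i j k l =>
      (chernTensor H z i j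
        + ((-c ^ 2) • ((torsion H j z)ᴴ * (H z)⁻¹ * torsion H i z)
        + (c • wirtingerMatrix (Sum.inl i) (cotorsion H j) z
        + ((-c) • wirtingerMatrix (Sum.inr j) (torsion H i) z
        + (c • (torsion H i z * ((H z)⁻¹ * (wirtingerMatrix (Sum.inr j) H z - c • cotorsion H j z)))
        + (-c) • (wirtingerMatrix (Sum.inl i) H z * (H z)⁻¹ * cotorsion H j z)))))) k l := by
    funext i j k l
    rw [curvatureTensor, ← hHdef, hcurv, h1, h2]
    refine congrFun (congrFun ?_ k) l
    simp only [S, Sum.elim_inl, Sum.elim_inr, chernTensor]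
    rw [cotorsion_eq g he hz, ← hHdef]
    simp only [Matrix.add_mul, Matrix.mul_sub, Matrix.smul_mul, Matrix.mul_smul,
      Matrix.mul_assoc, Matrix.neg_mul, Matrix.mul_neg, add_sub_cancel_left]
    simp only [smul_sub, smul_add, smul_neg, neg_smul, smul_smul, pow_two]
    abel
  have z1 : contract (fun i j => wirtingerMatrix (Sum.inl i) (cotorsion H j) z) v = 0 :=
    contract_eq_zero_of_antisymm_right v fun i j k l => by
      simp only [wirtingerMatrix, Matrix.of_apply]
      rw [← wirtinger_neg]
      exact congrArg (wirtinger _ · z) (funext fun y => cotorsion_antisymm H y j k l)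
  have z2 : contract (fun i j => wirtingerMatrix (Sum.inr j) (torsion H i) z) v = 0 :=
    contract_eq_zero_of_antisymm_left v fun i j k l => by
      simp only [wirtingerMatrix, Matrix.of_apply]
      rw [← wirtinger_neg]
      exact congrArg (wirtinger _ · z) (funext fun y => torsion_antisymm H y i k l)
  have z3 : contract (fun i j => torsion H i z *
      ((H z)⁻¹ * (wirtingerMatrix (Sum.inr j) H z - c • cotorsion H j z))) v = 0 :=
    contract_eq_zero_of_antisymm_left v fun i j k l => by
      rw [Matrix.mul_apply, Matrix.mul_apply, ← Finset.sum_neg_distrib]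
      exact Finset.sum_congr rfl fun d _ => by rw [torsion_antisymm, neg_mul]
  have z4 : contract (fun i j =>
      wirtingerMatrix (Sum.inl i) H z * (H z)⁻¹ * cotorsion H j z) v = 0 :=
    contract_eq_zero_of_antisymm_right v fun i j k l => by
      rw [Matrix.mul_apply, Matrix.mul_apply, ← Finset.sum_neg_distrib]
      exact Finset.sum_congr rfl fun d _ => by rw [cotorsion_antisymm, mul_neg]
  rw [hexp]
  change contract (fun i j => _) v = _
  rw [contract_add, contract_add, contract_add, contract_add, contract_add, contract_smul,
    contract_smul, contract_smul, contract_smul, contract_smul, z1, z2, z3, z4]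
  ring

end Curvature

/-! ### Pointwise comparison and conclusion -/

section Main

variable {n : ℕ} {X : Type*} [TopologicalSpace X] [ChartedSpace (Cn n) X]
  [IsManifold 𝓘(ℂ, Cn n) ω X] (g : HermitianMetric n X)

/-- The Gauduchon holomorphic sectional curvatures at `(x, v)` are real and of the form
`K - (1 - t)² N` with `N ≥ 0`. -/
theorem exists_complexHSC_gauduchon_eq (x : X) (v : TangentSpace 𝓘(ℂ, Cn n) x) :
    ∃ K N : ℝ, 0 ≤ N ∧
      ∀ t : ℝ, complexHSC g (gauduchon g t) x v = ((K - (1 - t) ^ 2 * N : ℝ) : ℂ) := by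
  open scoped ComplexOrder in
  have he : chartAt (Cn n) x ∈ atlas (Cn n) X := chart_mem_atlas _ x
  have hz : chartAt (Cn n) x x ∈ (chartAt (Cn n) x).target := mem_chart_target _ x
  generalize hedef : chartAt (Cn n) x = e at he hz
  generalize hzdef : e x = z at hz
  let w : Cn n := v
  let r : ℝ := 1 / 2 * realMetric g e z w w
  have hr : normSq g e z w = r := by
    rw [normSq, hMetric_sum_eq g he hz]; push_cast [r]; rfl
  have hK := contract_im_eq_zero w (chernTensor_eq_conjTranspose g he hz)
  have hN := contract_conjTranspose_mul_mul_nonneg w (hMetric_posDef g he hz).inv.posSemidef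
    (fun i => torsion (hMetric g e) i z)
  obtain ⟨hN0, hN1⟩ := Complex.nonneg_iff.1 hN
  -- The factor 4 comes from c² = (1 - t)²/4. The case v = 0 needs no separate treatment, since
  -- division by r² = 0 gives 0 on both sides.
  refine ⟨(contract (chernTensor (hMetric g e) z) w).re / r ^ 2,
    (contract (fun i j => (torsion (hMetric g e) j z)ᴴ * (hMetric g e z)⁻¹
      * torsion (hMetric g e) i z) w).re / 4 / r ^ 2, by positivity, fun t => ?_⟩
  have h1 : complexHSC g (gauduchon g t) x v
      = contract (curvatureTensor g e (gauduchon g t e) z) w / normSq g e z w ^ 2 := by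
    subst hzdef; subst hedef; rfl
  rw [h1, contract_gauduchon g t he hz, hr]
  have e1 := Complex.re_add_im (contract (chernTensor (hMetric g e) z) w)
  have e2 := Complex.re_add_im (contract (fun i j => (torsion (hMetric g e) j z)ᴴ
    * (hMetric g e z)⁻¹ * torsion (hMetric g e) i z) w)
  rw [hK] at e1
  rw [← hN1] at e2
  rw [← e1, ← e2]
  push_cast
  simp only [zero_mul, add_zero, Complex.ofReal_re]
  ring

theorem gauduchonHSC_le_chernHSC (t : ℝ) (x : X) (v : TangentSpace 𝓘(ℂ, Cn n) x) :
    gauduchonHSC g t x v ≤ chernHSC g x v := by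
  obtain ⟨K, N, hN, h⟩ := exists_complexHSC_gauduchon_eq g x v
  rw [gauduchonHSC, chernHSC, ← gauduchon_one, h, h, Complex.ofReal_re, Complex.ofReal_re]
  nlinarith [mul_nonneg (sq_nonneg (1 - t)) hN]

end Main

end Gauduchon

theorem mainTheorem6 (n : ℕ) (X : Type*) [TopologicalSpace X] [ChartedSpace (Gauduchon.Cn n) X]
    [IsManifold 𝓘(ℂ, Gauduchon.Cn n) ω X] (g : Gauduchon.HermitianMetric n X) :
    -- the holomorphic sectional curvatures are real
    (∀ (x : X) (v : TangentSpace 𝓘(ℂ, Gauduchon.Cn n) x),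
      (Gauduchon.complexHSC g (Gauduchon.chern g) x v).im = 0 ∧
      ∀ t : ℝ, (Gauduchon.complexHSC g (Gauduchon.gauduchon g t) x v).im = 0) ∧
    ((∀ (x : X) (v : TangentSpace 𝓘(ℂ, Gauduchon.Cn n) x), v ≠ 0 →
        Gauduchon.chernHSC g x v ≤ 0) →
      ∀ (t : ℝ) (x : X) (v : TangentSpace 𝓘(ℂ, Gauduchon.Cn n) x), v ≠ 0 →
        Gauduchon.gauduchonHSC g t x v ≤ 0) ∧
    ((∀ (x : X) (v : TangentSpace 𝓘(ℂ, Gauduchon.Cn n) x), v ≠ 0 →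
        Gauduchon.chernHSC g x v < 0) →
      ∀ (t : ℝ) (x : X) (v : TangentSpace 𝓘(ℂ, Gauduchon.Cn n) x), v ≠ 0 →
        Gauduchon.gauduchonHSC g t x v < 0) ∧
    ((∃ t : ℝ, ∀ (x : X) (v : TangentSpace 𝓘(ℂ, Gauduchon.Cn n) x), v ≠ 0 →
        0 < Gauduchon.gauduchonHSC g t x v) →
      ∀ (x : X) (v : TangentSpace 𝓘(ℂ, Gauduchon.Cn n) x), v ≠ 0 →
        0 < Gauduchon.chernHSC g x v) := by
  refine ⟨fun x v => ?_, fun h t x v hv => ?_, fun h t x v hv => ?_, fun ⟨t, h⟩ x v hv => ?_⟩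
  · obtain ⟨K, N, -, hKN⟩ := Gauduchon.exists_complexHSC_gauduchon_eq g x v
    rw [← Gauduchon.gauduchon_one, hKN]
    exact ⟨Complex.ofReal_im _, fun t => by rw [hKN]; exact Complex.ofReal_im _⟩
  · exact (Gauduchon.gauduchonHSC_le_chernHSC g t x v).trans (h x v hv)
  · exact (Gauduchon.gauduchonHSC_le_chernHSC g t x v).trans_lt (h x v hv)
  · exact (h x v hv).trans_le (Gauduchon.gauduchonHSC_le_chernHSC g t x v)
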